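/- Let $n\ge 3$, $a\neq 0$ and $B=aI_n$. Let $\Omega\subset\mathbb R^n$ be open and let $\tilde\Omega\subset\mathbb R^n$ be a bounded domain (a bounded connected open set, e.g. a bounded locally Lipschitz domain) with $\overline\Omega\subset\tilde\Omega$. Let $\rho\in C^1(\mathbb R^n)$ satisfy $\rho>0$ on $\mathbb R^n$ and $\rho(x)=\bar\rho$ (a constant) for $x\in\mathbb R^n\setminus\Omega$, and let $p\in C^1((0,\infty))$ satisfy $\int_\Omega p(\rho(x))\,dx=p(\bar\rho)\,|\Omega|$. Write $\mathbb S_0^{n\times n}$ for the symmetric trace-free real $n\times n$ matrices. Then there exist continuous functions $\tilde m:\mathbb R^n\to\mathbb R^n$, $\tilde U:\mathbb R^n\to\mathbb S_0^{n\times n}$ and a constant $\chi\in\mathbb R$ such that, with $q(x)=p(\rho(x))+\frac{\chi}{n}$, 1. $\operatorname{supp}(\tilde m,\tilde U)$ is a compact subset of $\tilde\Omega$; 2. $\operatorname{div}\tilde m=0$ and $\operatorname{div}\tilde U+\nabla q=B\tilde m$ on $\mathbb R^n$ in the sense of distributions; 3. $\tilde m(x)\otimes\tilde m(x)-\rho(x)\tilde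 U(x)<\rho(x)q(x)I_n$ for all $x\in\mathbb R^n$, in the sense of symmetric matrices. Moreover this is a compactly supported strict subsolution in the following sense. For $\alpha,\beta>0$ let $$K_{\alpha,\beta}=\Bigl\{(m,U)\in\mathbb R^n\times\mathbb S_0^{n\times n}:\ \tfrac{m\otimes m}{\alpha}-U=\beta I_n\Bigr\},$$ let $K_{\alpha,\beta}^{\mathrm{co}}$ be its convex hull, and take interiors in $\mathbb R^n\times\mathbb S_0^{n\times n}$. For all $x\in\mathbb R^n$ one has $q(x)>0$ and $(\tilde m,\tilde U)(x)$ lies in the interior of $K_{\rho(x),q(x)}^{\mathrm{co}}$. Also, with $r=\frac{\chi}{n}>0$, the quadruple $(\rho,\tilde m,\tilde U,r)$ is bounded and continuous, solves $$\operatorname{div}\tilde m=0,\qquad \operatorname{div}\tilde U+\nabla(p(\rho)+r)=B\tilde m$$ in the sense of distributions, and $(\tilde m,\tilde U)(x)$ lies in the interior of $K_{\rho(x),r}^{\mathrm{co}}$ for all $x\in\mathbb R^n$. -/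

import Mathlib

open MeasureTheory

noncomputable section

namespace SteadyEuler

/-- `ℝⁿ` with its Euclidean norm and Lebesgue measure. -/
abbrev E (n : ℕ) : Type := EuclideanSpace ℝ (Fin n)

/-- The space of real symmetric trace-free `n × n` matrices. -/
def SymTraceless (n : ℕ) : Submodule ℝ (Matrix (Fin n) (Fin n) ℝ) where
  carrier := {A | A.transpose = A ∧ A.trace = 0}
  add_mem' := by
    rintro A B ⟨hA, hA'⟩ ⟨hB, hB'⟩
    exact ⟨by rw [Matrix.transpose_add, hA, hB], by rw [Matrix.trace_add, hA', hB', add_zero]⟩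
  zero_mem' := ⟨Matrix.transpose_zero, Matrix.trace_zero _ _⟩
  smul_mem' := by
    rintro c A ⟨hA, hA'⟩
    exact ⟨by rw [Matrix.transpose_smul, hA], by rw [Matrix.trace_smul, hA', smul_zero]⟩

/-- The rank one matrix `m ⊗ m`. -/
def tensorSq {n : ℕ} (m : E n) : Matrix (Fin n) (Fin n) ℝ :=
  Matrix.of fun i j => m i * m j

/-- The constraint set `K_{a,b}` of all pairs `(m, U)` with `(m ⊗ m) / a - U = b I`. -/
def constraintSet (n : ℕ) (a b : ℝ) : Set (E n × SymTraceless n) :=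
  {w | a⁻¹ • tensorSq w.1 - (w.2 : Matrix (Fin n) (Fin n) ℝ) = b • 1}

/-- The partial derivative `∂ψ/∂xᵢ` at `x`. -/
def partialDeriv {n : ℕ} (i : Fin n) (ψ : E n → ℝ) (x : E n) : ℝ :=
  fderiv ℝ ψ x (EuclideanSpace.single i 1)

/-- Scalar test functions, i.e. elements of `C_c^∞(ℝⁿ)`. -/
def IsTestFunction {n : ℕ} (ψ : E n → ℝ) : Prop :=
  ContDiff ℝ ((⊤ : ℕ∞) : WithTop ℕ∞) ψ ∧ HasCompactSupport ψ

/-- `div m = 0` on `ℝⁿ` in the sense of distributions. -/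
def WeakDivFree {n : ℕ} (m : E n → E n) : Prop :=
  ∀ ψ : E n → ℝ, IsTestFunction ψ → ∫ x, ∑ i, m x i * partialDeriv i ψ x = 0

/-- `div U + ∇P = B m` on `ℝⁿ` in the sense of distributions, where
`(div U)ᵢ = ∑ⱼ ∂ⱼ Uᵢⱼ`. -/
def WeakMomentum {n : ℕ} (B : Matrix (Fin n) (Fin n) ℝ) (m : E n → E n)
    (U : E n → SymTraceless n) (P : E n → ℝ) : Prop :=
  ∀ (i : Fin n) (ψ : E n → ℝ), IsTestFunction ψ →
    ∫ x, ((∑ j, (U x : Matrix (Fin n) (Fin n) ℝ) i j * partialDeriv j ψ x)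
      + P x * partialDeriv i ψ x + B.mulVec (m x).ofLp i * ψ x) = 0

/-- `(ρ, m, U, r)` is a subsolution on `ℝⁿ` of the steady compressible Euler equations with
pressure law `p` and source `B m`: a bounded measurable quadruple with `ρ > 0` that solves
`div m = 0`, `div U + ∇(p(ρ) + r) = B m` in the sense of distributions, with values `(m, U)(x)`
in the convex hull of `K_{ρ(x), r(x)}`. -/
structure IsSubsolution {n : ℕ} (p : ℝ → ℝ) (B : Matrix (Fin n) (Fin n) ℝ)
    (ρ : E n → ℝ) (m : E n → E n) (U : E n → SymTraceless n) (r : E n → ℝ) : Prop where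
  bdd_density : MemLp ρ ⊤ volume
  bdd_momentum : MemLp m ⊤ volume
  bdd_stress : ∀ i j, MemLp (fun x => (U x : Matrix (Fin n) (Fin n) ℝ) i j) ⊤ volume
  bdd_level : MemLp r ⊤ volume
  density_pos : ∀ᵐ x, 0 < ρ x
  div_free : WeakDivFree m
  momentum : WeakMomentum B m U (fun x => p (ρ x) + r x)
  mem_hull : ∀ᵐ x, (m x, U x) ∈ convexHull ℝ (constraintSet n (ρ x) (r x))

/-- The subsolution is strict in the open set `D`, with constraint sets `K_{ρ(x), r(x)}`: it is
continuous, and for `x ∈ D` one has `ρ(x) > 0`, `r(x) > 0` and `(m, U)(x)` lies in the interior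
(taken in `ℝⁿ` times the symmetric trace-free matrices) of the convex hull of `K_{ρ(x), r(x)}`.
These sets are compact and depend continuously on `x ∈ D` in the Hausdorff distance, because `ρ`
and `r` are continuous and positive on `D`. -/
structure IsStrictSubsolution {n : ℕ} (p : ℝ → ℝ) (B : Matrix (Fin n) (Fin n) ℝ)
    (ρ : E n → ℝ) (m : E n → E n) (U : E n → SymTraceless n) (r : E n → ℝ)
    (D : Set (E n)) : Prop extends IsSubsolution p B ρ m U r where
  isOpen_domain : IsOpen D
  continuous_density : Continuous ρ
  continuous_momentum : Continuous m
  continuous_stress : Continuous U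
  continuous_level : Continuous r
  density_pos_on : ∀ x ∈ D, 0 < ρ x
  level_pos_on : ∀ x ∈ D, 0 < r x
  mem_interior_hull : ∀ x ∈ D,
    (m x, U x) ∈ interior (convexHull ℝ (constraintSet n (ρ x) (r x)))

end SteadyEuler

end

/-! Put `P = p(ρ) - p(ρ̄)`, a function with zero integral and compact support in the connected set
`Ω'`.

The key point is to write `P = div Y` with `Y` of class `C¹` and compactly supported in `Ω'`, and
with `curl Y` of class `C¹` as well. Let `φ` be a radial mollifier. Moving the mass of `φ` along
segments to its centre writes `P - P ⋆ φ` as the divergence of a `C¹` field, which is curl-free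
because `φ` is radial. The smooth remainder `P ⋆ φ` is the divergence of a smooth field: along
chains of balls in `Ω'` its mass can be gathered at one point, where it cancels.

Then `U = -c (∇Y + ∇Yᵀ - (2/n) P I)`, with the constant `c` for which the gradient terms `∇P`
cancel, has `div U + ∇P` equal to the divergence of an antisymmetric multiple of `curl Y`. So the
momentum equation holds when `a m` is that divergence, and `m` is divergence-free.

Finally, the convex hull of `K_{α, β}` contains every state with `αβ I - (m ⊗ m - α U) ≥ 0`: split
this matrix into rank-one pieces and remove them one at a time. Since `m` and `U` are bounded and
vanish off a compact set, a large constant `χ` makes the inequality strict everywhere.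
-/

noncomputable section

namespace SteadyEuler

open scoped ContDiff Pointwise Convolution

universe u

section Cc

variable {V F : Type*} [NormedAddCommGroup V] [NormedSpace ℝ V]
  [NormedAddCommGroup F] [NormedSpace ℝ F]

/-- The space `C_c^k(D)` of functions of class `C^k` whose support is a compact subset of `D`. -/
def Cc (k : ℕ∞) (D : Set V) : Submodule ℝ (V → F) where
  carrier := {f | ContDiff ℝ k f ∧ HasCompactSupport f ∧ tsupport f ⊆ D}
  zero_mem' := ⟨contDiff_const, .zero, by simp [tsupport]⟩
  add_mem' := fun ⟨hf, hfc, hfD⟩ ⟨hg, hgc, hgD⟩ =>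
    ⟨hf.add hg, hfc.add hgc, (tsupport_add _ _).trans (Set.union_subset hfD hgD)⟩
  smul_mem' := fun a f ⟨hf, hfc, hfD⟩ =>
    ⟨hf.const_smul a, hfc.smul_left (f := fun _ => a),
      (tsupport_smul_subset_right (fun _ => a) f).trans hfD⟩

variable {k l : ℕ∞} {D D' : Set V} {f : V → F}

theorem Cc_mono (hkl : k ≤ l) (hD : D ⊆ D') (hf : f ∈ Cc l D) : f ∈ Cc k D' :=
  ⟨hf.1.of_le (by exact_mod_cast hkl), hf.2.1, hf.2.2.trans hD⟩

end Cc

section TransAvg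

variable {X : Type*} [MeasurableSpace X] {V F : Type u} [NormedAddCommGroup V]
  [NormedAddCommGroup F] [NormedSpace ℝ F]

/-- The average `∫ w(ξ) f(x - g(ξ)) dμ(ξ)` of the translates of `f` by `g(ξ)` with weight `w`:
the convolution of `f` with the image under `g` of the signed measure `w μ`. -/
def transAvg (μ : Measure X) (w : X → ℝ) (g : X → V) (f : V → F) (x : V) : F :=
  ∫ ξ, w ξ • f (x - g ξ) ∂μ

variable {μ : Measure X} {w : X → ℝ} {g : X → V} {f : V → F}

theorem aestronglyMeasurable_transAvg (hw : Integrable w μ) (hg : AEStronglyMeasurable g μ)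
    (hf : Continuous f) (x : V) : AEStronglyMeasurable (fun ξ => w ξ • f (x - g ξ)) μ :=
  hw.1.smul (hf.comp_aestronglyMeasurable (aestronglyMeasurable_const.sub hg))

theorem integrable_transAvg (hw : Integrable w μ) (hg : AEStronglyMeasurable g μ)
    (hf : Continuous f) (hfc : HasCompactSupport f) (x : V) :
    Integrable (fun ξ => w ξ • f (x - g ξ)) μ := by
  obtain ⟨C, hC⟩ := hfc.exists_bound_of_continuous hf
  refine (hw.norm.mul_const C).mono' (aestronglyMeasurable_transAvg hw hg hf x) ?_
  filter_upwards with ξ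
  rw [norm_smul]
  gcongr
  exact hC _

theorem continuous_transAvg (hw : Integrable w μ) (hg : AEStronglyMeasurable g μ)
    (hf : Continuous f) (hfc : HasCompactSupport f) : Continuous (transAvg μ w g f) := by
  obtain ⟨C, hC⟩ := hfc.exists_bound_of_continuous hf
  refine continuous_of_dominated (bound := fun ξ => ‖w ξ‖ * C)
    (aestronglyMeasurable_transAvg hw hg hf) (fun x => ?_) (hw.norm.mul_const C) ?_
  · filter_upwards with ξ
    rw [norm_smul]
    gcongr
    exact hC _
  · filter_upwards with ξ
    fun_prop

theorem tsupport_transAvg_subset {G : Set V} (hG : IsCompact G)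
    (hwG : ∀ᵐ ξ ∂μ, w ξ ≠ 0 → g ξ ∈ G) (hfc : HasCompactSupport f) :
    tsupport (transAvg μ w g f) ⊆ tsupport f + G := by
  refine closure_minimal (fun x hx => ?_) (hfc.isCompact.add hG).isClosed
  by_contra hx'
  refine hx (integral_eq_zero_of_ae ?_)
  filter_upwards [hwG] with ξ hξ
  by_cases h0 : w ξ = 0
  · simp [h0]
  · have : x - g ξ ∉ tsupport f := fun hmem => hx' ⟨x - g ξ, hmem, g ξ, hξ h0, by simp⟩
    simp [image_eq_zero_of_notMem_tsupport this]

variable [NormedSpace ℝ V]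

theorem hasFDerivAt_transAvg (hw : Integrable w μ) (hg : AEStronglyMeasurable g μ)
    (hf : ContDiff ℝ 1 f) (hfc : HasCompactSupport f) (x : V) :
    HasFDerivAt (transAvg μ w g f) (transAvg μ w g (fderiv ℝ f) x) x := by
  have hf' : Continuous (fderiv ℝ f) := hf.continuous_fderiv one_ne_zero
  obtain ⟨C, hC⟩ := (hfc.fderiv ℝ).exists_bound_of_continuous hf'
  refine hasFDerivAt_integral_of_dominated_of_fderiv_le (bound := fun ξ => ‖w ξ‖ * C)
    (F' := fun x ξ => w ξ • fderiv ℝ f (x - g ξ))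
    Filter.univ_mem (.of_forall (aestronglyMeasurable_transAvg hw hg hf.continuous))
    (integrable_transAvg hw hg hf.continuous hfc x)
    (aestronglyMeasurable_transAvg hw hg hf' x) ?_ (hw.norm.mul_const C) ?_
  · filter_upwards with ξ y _
    rw [norm_smul]
    gcongr
    exact hC _
  · filter_upwards with ξ y _
    have h := (hf.differentiable one_ne_zero (y - g ξ)).hasFDerivAt
    exact ((hasFDerivAt_comp_sub (g ξ)).2 h).const_smul (w ξ)

theorem contDiff_transAvg {k : ℕ∞} (hw : Integrable w μ) (hg : AEStronglyMeasurable g μ)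
    (hf : ContDiff ℝ k f) (hfc : HasCompactSupport f) : ContDiff ℝ k (transAvg μ w g f) := by
  induction k using ENat.nat_induction generalizing F with
  | zero => exact contDiff_zero.2 (continuous_transAvg hw hg hf.continuous hfc)
  | succ k ih =>
    have h1 : ContDiff ℝ 1 f := hf.of_le (by exact_mod_cast Nat.le_add_left 1 k)
    exact contDiff_succ_iff_hasFDerivAt.2 ⟨transAvg μ w g (fderiv ℝ f),
      ih (hf.fderiv_right (by norm_cast)) (hfc.fderiv ℝ), hasFDerivAt_transAvg hw hg h1 hfc⟩
  | top ih => exact contDiff_infty.2 fun k => ih k (contDiff_infty.1 hf k) hfc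

theorem transAvg_mem_Cc {k : ℕ∞} {D D' G : Set V} (hw : Integrable w μ)
    (hg : AEStronglyMeasurable g μ) (hG : IsCompact G) (hwG : ∀ᵐ ξ ∂μ, w ξ ≠ 0 → g ξ ∈ G)
    (hf : f ∈ Cc k D) (hD : D + G ⊆ D') : transAvg μ w g f ∈ Cc k D' := by
  have hsub := tsupport_transAvg_subset hG hwG hf.2.1
  exact ⟨contDiff_transAvg hw hg hf.1 hf.2.1,
    (hf.2.1.isCompact.add hG).of_isClosed_subset (isClosed_tsupport _) hsub,
    hsub.trans ((Set.add_subset_add_right hf.2.2).trans hD)⟩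

end TransAvg

variable {n : ℕ} {D : Set (E n)}

section PartialDeriv

variable {f g : E n → ℝ}

theorem contDiff_partialDeriv {k l : ℕ∞ω} (hf : ContDiff ℝ l f) (hkl : k + 1 ≤ l) (i : Fin n) :
    ContDiff ℝ k (partialDeriv i f) :=
  (hf.fderiv_right hkl).clm_apply contDiff_const

theorem continuous_partialDeriv (hf : ContDiff ℝ 1 f) (i : Fin n) :
    Continuous (partialDeriv i f) :=
  (contDiff_partialDeriv hf (zero_add 1).le i).continuous

theorem partialDeriv_mem_Cc {k l : ℕ∞} (hf : f ∈ Cc l D) (hkl : k + 1 ≤ l) (i : Fin n) :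
    partialDeriv i f ∈ Cc k D :=
  ⟨contDiff_partialDeriv hf.1 (by exact_mod_cast hkl) i, hf.2.1.fderiv_apply ℝ _,
    (tsupport_fderiv_apply_subset ℝ _).trans hf.2.2⟩

theorem partialDeriv_add (hf : Differentiable ℝ f) (hg : Differentiable ℝ g) (i : Fin n) :
    partialDeriv i (f + g) = partialDeriv i f + partialDeriv i g := by
  ext x
  simp [partialDeriv, fderiv_add (hf x) (hg x)]

theorem partialDeriv_const_smul (hf : Differentiable ℝ f) (a : ℝ) (i : Fin n) :
    partialDeriv i (a • f) = a • partialDeriv i f := by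
  ext x
  simp [partialDeriv, fderiv_const_smul (hf x)]

theorem partialDeriv_comm (hf : ContDiff ℝ 2 f) (i j : Fin n) :
    partialDeriv i (partialDeriv j f) = partialDeriv j (partialDeriv i f) := by
  ext x
  have hd : DifferentiableAt ℝ (fderiv ℝ f) x :=
    (hf.fderiv_right (m := 1) (by norm_num)).differentiable one_ne_zero x
  have second (i j : Fin n) : partialDeriv i (partialDeriv j f) x =
      fderiv ℝ (fderiv ℝ f) x (EuclideanSpace.single i 1) (EuclideanSpace.single j 1) := by
    have h := hd.hasFDerivAt.clm_apply (hasFDerivAt_const (EuclideanSpace.single j (1 : ℝ)) x)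
    rw [partialDeriv, show partialDeriv j f = fun y => fderiv ℝ f y (EuclideanSpace.single j 1)
      from rfl, h.fderiv]
    simp
  rw [second, second]
  exact (hf.contDiffAt.isSymmSndFDerivAt (by simp)).eq _ _

theorem fderiv_eq_sum_partialDeriv (f : E n → ℝ) (x v : E n) :
    fderiv ℝ f x v = ∑ i, v i * partialDeriv i f x := by
  have hv : v = ∑ i, v i • EuclideanSpace.single i (1 : ℝ) := by
    simpa using ((EuclideanSpace.basisFun (Fin n) ℝ).sum_repr v).symm
  conv_lhs => rw [hv, map_sum]
  simp [partialDeriv]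

theorem partialDeriv_transAvg {X : Type*} [MeasurableSpace X] {μ : Measure X} {w : X → ℝ}
    {g : X → E n} (hw : Integrable w μ) (hg : AEStronglyMeasurable g μ) (hf : f ∈ Cc 1 D)
    (i : Fin n) : partialDeriv i (transAvg μ w g f) = transAvg μ w g (partialDeriv i f) := by
  ext x
  rw [partialDeriv, (hasFDerivAt_transAvg hw hg hf.1 hf.2.1 x).fderiv, transAvg,
    ContinuousLinearMap.integral_apply (integrable_transAvg hw hg
      (hf.1.continuous_fderiv one_ne_zero) (hf.2.1.fderiv ℝ) x)]
  rfl

theorem integral_mul_partialDeriv (hf : ContDiff ℝ 1 f) (hg : g ∈ Cc 1 D) (i : Fin n) :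
    ∫ x, f x * partialDeriv i g x = - ∫ x, partialDeriv i f x * g x := by
  have hg' := partialDeriv_mem_Cc hg (zero_add 1).le i
  refine integral_mul_fderiv_eq_neg_fderiv_mul_of_integrable ?_ ?_ ?_
    (fun x _ => hf.differentiable one_ne_zero x) (fun x _ => hg.1.differentiable one_ne_zero x)
  · exact ((continuous_partialDeriv hf i).mul hg.1.continuous).integrable_of_hasCompactSupport
      hg.2.1.mul_left
  · exact (hf.continuous.mul hg'.1.continuous).integrable_of_hasCompactSupport hg'.2.1.mul_left
  · exact (hf.continuous.mul hg.1.continuous).integrable_of_hasCompactSupport hg.2.1.mul_left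

theorem integral_partialDeriv_mul_comm {v : Fin n → E n → ℝ} (hf : ContDiff ℝ 1 f)
    (hv : ∀ i, v i ∈ Cc 1 D) {i j : Fin n} (hij : partialDeriv i (v j) = partialDeriv j (v i)) :
    ∫ x, partialDeriv i f x * v j x = ∫ x, partialDeriv j f x * v i x := by
  rw [← neg_inj, ← integral_mul_partialDeriv hf (hv j), ← integral_mul_partialDeriv hf (hv i), hij]

/-- The divergence `∑ᵢ ∂ᵢVᵢ` of the vector field with components `Vᵢ`. -/
def divergence (V : Fin n → E n → ℝ) : E n → ℝ :=
  ∑ i, partialDeriv i (V i)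

theorem divergence_add {V W : Fin n → E n → ℝ} (hV : ∀ i, Differentiable ℝ (V i))
    (hW : ∀ i, Differentiable ℝ (W i)) : divergence (V + W) = divergence V + divergence W := by
  simp only [divergence, Pi.add_apply, partialDeriv_add (hV _) (hW _), Finset.sum_add_distrib]

theorem divergence_const_smul {V : Fin n → E n → ℝ} (hV : ∀ i, Differentiable ℝ (V i)) (a : ℝ) :
    divergence (a • V) = a • divergence V := by
  simp only [divergence, Pi.smul_apply, partialDeriv_const_smul (hV _), Finset.smul_sum]

end PartialDeriv

section SegmentField

variable {ν : Measure (E n)} {k f : E n → ℝ} {c : E n} {r : ℝ}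

/-- The measure `dt ⊗ ν` on `[0,1] × ℝⁿ`. -/
def segMeasure (ν : Measure (E n)) : Measure (ℝ × E n) :=
  (volume.restrict (Set.Icc (0 : ℝ) 1)).prod ν

/-- The weight `k(y) (y - c)ᵢ` at `(t, y)`. -/
def segWeight (k : E n → ℝ) (c : E n) (i : Fin n) (ξ : ℝ × E n) : ℝ := k ξ.2 * (ξ.2 - c) i

/-- The point `(1 - t) c + t y` at `(t, y)`. -/
def segPoint (c : E n) (ξ : ℝ × E n) : E n := AffineMap.lineMap c ξ.2 ξ.1

/-- The vector field `∫₀¹ ∫ k(y) (y - c) f(x - c - t (y - c)) dν(y) dt`, which carries the mass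
`k ν` along straight segments to the point `c`, smeared out by `f`. -/
def segmentField (ν : Measure (E n)) (k : E n → ℝ) (c : E n) (f : E n → ℝ) (i : Fin n) :
    E n → ℝ :=
  transAvg (segMeasure ν) (segWeight k c i) (segPoint c) f

theorem continuous_segPoint : Continuous (segPoint c) := by
  unfold segPoint
  simp only [AffineMap.lineMap_apply_module']
  fun_prop

theorem integrable_segWeight [SFinite ν] (hk : Integrable k ν)
    (hkc : ∀ᵐ y ∂ν, k y ≠ 0 → y ∈ Metric.closedBall c r) (i : Fin n) :
    Integrable (segWeight k c i) (segMeasure ν) := by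
  suffices Integrable (fun y => k y * (y - c) i) ν from this.comp_snd _
  refine (hk.norm.mul_const r).mono'
    (hk.1.mul (Continuous.aestronglyMeasurable (by fun_prop))) ?_
  filter_upwards [hkc] with y hy
  by_cases h0 : k y = 0
  · simp [h0]
  · rw [norm_mul]
    gcongr
    exact (PiLp.norm_apply_le _ _).trans (by simpa [dist_eq_norm] using hy h0)

theorem segPoint_mem_closedBall [SFinite ν] (hkc : ∀ᵐ y ∂ν, k y ≠ 0 → y ∈ Metric.closedBall c r)
    (i : Fin n) :
    ∀ᵐ ξ ∂segMeasure ν, segWeight k c i ξ ≠ 0 → segPoint c ξ ∈ Metric.closedBall c r := by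
  filter_upwards [Measure.quasiMeasurePreserving_fst.ae (ae_restrict_mem measurableSet_Icc),
    Measure.quasiMeasurePreserving_snd.ae hkc] with ξ ht hy h0
  have hy := hy (left_ne_zero_of_mul h0)
  exact (convex_closedBall c r).lineMap_mem
    (Metric.mem_closedBall_self (dist_nonneg.trans hy)) hy ht

theorem segmentField_mem_Cc [SFinite ν] (hk : Integrable k ν)
    (hkc : ∀ᵐ y ∂ν, k y ≠ 0 → y ∈ Metric.closedBall c r) {l : ℕ∞} {S : Set (E n)}
    (hf : f ∈ Cc l S) (hD : S + Metric.closedBall c r ⊆ D) (i : Fin n) :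
    segmentField ν k c f i ∈ Cc l D :=
  transAvg_mem_Cc (integrable_segWeight hk hkc i) continuous_segPoint.aestronglyMeasurable
    (isCompact_closedBall c r) (segPoint_mem_closedBall hkc i) hf hD

theorem partialDeriv_segmentField [SFinite ν] (hk : Integrable k ν)
    (hkc : ∀ᵐ y ∂ν, k y ≠ 0 → y ∈ Metric.closedBall c r) (hf : f ∈ Cc 1 D) (i j : Fin n) :
    partialDeriv j (segmentField ν k c f i) = segmentField ν k c (partialDeriv j f) i :=
  partialDeriv_transAvg (integrable_segWeight hk hkc i)
    continuous_segPoint.aestronglyMeasurable hf j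

theorem integrable_segmentField [SFinite ν] (hk : Integrable k ν)
    (hkc : ∀ᵐ y ∂ν, k y ≠ 0 → y ∈ Metric.closedBall c r) (hf : f ∈ Cc 0 D) (i : Fin n) (x : E n) :
    Integrable (fun ξ => segWeight k c i ξ • f (x - segPoint c ξ)) (segMeasure ν) :=
  integrable_transAvg (integrable_segWeight hk hkc i) continuous_segPoint.aestronglyMeasurable
    hf.1.continuous hf.2.1 x

theorem integral_segWeight_mul_partialDeriv (hf : ContDiff ℝ 1 f) (x y : E n) :
    ∫ t in Set.Icc (0 : ℝ) 1, ∑ i, segWeight k c i (t, y) •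
      partialDeriv i f (x - segPoint c (t, y)) = k y * (f (x - c) - f (x - y)) := by
  have hderiv (t : ℝ) : HasDerivAt (fun t => -(k y * f (x - segPoint c (t, y))))
      (∑ i, segWeight k c i (t, y) • partialDeriv i f (x - segPoint c (t, y))) t := by
    have hline : HasDerivAt (fun t => x - segPoint c (t, y)) (-(y - c)) t :=
      AffineMap.hasDerivAt_lineMap.const_sub x
    refine (((hf.differentiable one_ne_zero _).hasFDerivAt.comp_hasDerivAt t hline).const_mul
      (k y)).neg.congr_deriv ?_
    rw [map_neg, fderiv_eq_sum_partialDeriv]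
    simp [segWeight, Finset.mul_sum, mul_assoc]
  have hcont : Continuous fun t =>
      ∑ i, segWeight k c i (t, y) • partialDeriv i f (x - segPoint c (t, y)) := by
    refine continuous_finsetSum _ fun i _ => Continuous.const_smul ?_ (k y * (y - c) i)
    exact (continuous_partialDeriv hf i).comp
      (continuous_const.sub (continuous_segPoint.comp (by fun_prop)))
  rw [integral_Icc_eq_integral_Ioc, ← intervalIntegral.integral_of_le zero_le_one,
    intervalIntegral.integral_eq_sub_of_hasDerivAt (fun t _ => hderiv t)
      (hcont.intervalIntegrable _ _)]
  simp only [segPoint, AffineMap.lineMap_apply_one, AffineMap.lineMap_apply_zero]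
  ring

theorem divergence_segmentField [SFinite ν] (hk : Integrable k ν)
    (hkc : ∀ᵐ y ∂ν, k y ≠ 0 → y ∈ Metric.closedBall c r) (hf : f ∈ Cc 1 D) (x : E n) :
    divergence (segmentField ν k c f) x =
      (∫ y, k y ∂ν) * f (x - c) - (k ⋆[ContinuousLinearMap.mul ℝ ℝ, ν] f) x := by
  have hint (i : Fin n) := integrable_segmentField hk hkc
    (partialDeriv_mem_Cc hf (zero_add 1).le i) i x
  calc divergence (segmentField ν k c f) x
      = ∑ i, ∫ ξ, segWeight k c i ξ • partialDeriv i f (x - segPoint c ξ) ∂segMeasure ν := by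
        simp only [divergence, partialDeriv_segmentField hk hkc hf, Finset.sum_apply]
        rfl
    _ = ∫ y, k y * (f (x - c) - f (x - y)) ∂ν := by
        rw [← integral_finsetSum _ fun i _ => hint i, segMeasure,
          integral_prod_symm _ (integrable_finsetSum _ fun i _ => hint i)]
        simp only [integral_segWeight_mul_partialDeriv hf.1]
    _ = _ := by
        have hconv : Integrable (fun y => k y * f (x - y)) ν :=
          integrable_transAvg hk aestronglyMeasurable_id hf.1.continuous hf.2.1 x
        simp only [mul_sub, convolution_mul]
        rw [integral_sub (hk.mul_const _) hconv, integral_mul_const]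

theorem partialDeriv_comp_sub_smul (hf : Differentiable ℝ f) (t : ℝ) (x z : E n) (i : Fin n) :
    partialDeriv i (fun z => f (x - t • z)) z = -t * partialDeriv i f (x - t • z) := by
  have hline : HasFDerivAt (fun z : E n => x - t • z) (-(t • ContinuousLinearMap.id ℝ (E n))) z :=
    ((hasFDerivAt_id z).const_smul t).const_sub x
  have hcomp : HasFDerivAt (fun z => f (x - t • z)) _ z := (hf _).hasFDerivAt.comp z hline
  rw [partialDeriv, hcomp.fderiv]
  simp [partialDeriv]

theorem partialDeriv_segmentField_comm {φ : E n → ℝ} (hφ : φ ∈ Cc 1 (Metric.closedBall 0 r))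
    {i j : Fin n} (hij : partialDeriv j (fun z => z i * φ z) = partialDeriv i fun z => z j * φ z)
    (hf : f ∈ Cc 1 D) :
    partialDeriv j (segmentField volume φ 0 f i) =
      partialDeriv i (segmentField volume φ 0 f j) := by
  have hφi : Integrable φ := hφ.1.continuous.integrable_of_hasCompactSupport hφ.2.1
  have hφr : ∀ᵐ y, φ y ≠ 0 → y ∈ Metric.closedBall 0 r :=
    .of_forall fun y hy => hφ.2.2 (subset_tsupport _ hy)
  have hmoment (i : Fin n) : (fun z => z i * φ z) ∈ Cc 1 (Metric.closedBall 0 r) :=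
    ⟨ContDiff.mul (by fun_prop) hφ.1, hφ.2.1.mul_left,
      tsupport_mul_subset_right.trans hφ.2.2⟩
  ext x
  -- Integrating by parts in `z` moves both derivatives onto the curl-free moment field `z φ(z)`.
  have hslice (t : ℝ) (ht : t ≠ 0) : ∫ z, z i * φ z * partialDeriv j f (x - t • z) =
      ∫ z, z j * φ z * partialDeriv i f (x - t • z) := by
    have h := integral_partialDeriv_mul_comm (f := fun z => f (x - t • z))
      (by have := hf.1; fun_prop) hmoment hij
    simp only [partialDeriv_comp_sub_smul (hf.1.differentiable one_ne_zero), mul_assoc,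
      integral_const_mul] at h
    simpa [mul_comm] using mul_left_cancel₀ (neg_ne_zero.2 ht) h
  have hint (i j : Fin n) := integrable_segmentField hφi hφr
    (partialDeriv_mem_Cc hf (zero_add 1).le j) i x
  rw [partialDeriv_segmentField hφi hφr hf, partialDeriv_segmentField hφi hφr hf]
  simp only [segmentField, transAvg, segMeasure] at hint ⊢
  rw [integral_prod _ (hint i j), integral_prod _ (hint j i)]
  refine integral_congr_ae ?_
  filter_upwards [Measure.ae_ne _ (0 : ℝ)] with t ht
  simpa [segWeight, segPoint, AffineMap.lineMap_apply_module', mul_comm] using hslice t ht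

end SegmentField

section Gathering

/-- The divergences of smooth vector fields with compact support in `D`. -/
def divergences (D : Set (E n)) : Submodule ℝ (E n → ℝ) where
  carrier := {f | ∃ W, (∀ i, W i ∈ Cc ⊤ D) ∧ divergence W = f}
  zero_mem' := ⟨0, fun _ => zero_mem _, by ext; simp [divergence, partialDeriv]⟩
  add_mem' := by
    rintro _ _ ⟨V, hV, rfl⟩ ⟨W, hW, rfl⟩
    exact ⟨V + W, fun i => add_mem (hV i) (hW i), divergence_add
      (fun i => (hV i).1.differentiable (by simp)) fun i => (hW i).1.differentiable (by simp)⟩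
  smul_mem' := by
    rintro a _ ⟨W, hW, rfl⟩
    exact ⟨a • W, fun i => Submodule.smul_mem _ a (hW i),
      divergence_const_smul (fun i => (hW i).1.differentiable (by simp)) a⟩

theorem sub_convolution_mem_divergences {ν : Measure (E n)} [SFinite ν] {k ψ : E n → ℝ} {c : E n}
    {r ε : ℝ} (hψ : ψ ∈ Cc ⊤ (Metric.closedBall 0 ε)) (hk : Integrable k ν)
    (hkc : ∀ᵐ y ∂ν, k y ≠ 0 → y ∈ Metric.closedBall c r) (hD : Metric.closedBall c (r + ε) ⊆ D) :
    (fun x => (∫ y, k y ∂ν) * ψ (x - c) - (k ⋆[ContinuousLinearMap.mul ℝ ℝ, ν] ψ) x)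
      ∈ divergences D := by
  refine ⟨segmentField ν k c ψ, segmentField_mem_Cc hk hkc hψ ?_,
    funext (divergence_segmentField hk hkc (Cc_mono le_top subset_rfl hψ))⟩
  rintro _ ⟨u, hu, v, hv, rfl⟩
  refine hD ?_
  simp only [Metric.mem_closedBall, dist_eq_norm, sub_zero] at hu hv ⊢
  calc ‖u + v - c‖ = ‖(v - c) + u‖ := by congr 1; abel
    _ ≤ r + ε := norm_add_le_of_le hv hu

theorem exists_translate_sub_translate_mem_divergences (hD : IsOpen D) (hDc : IsPreconnected D)
    {x y : E n} (hx : x ∈ D) (hy : y ∈ D) :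
    ∃ ε > 0, ∀ ψ ∈ Cc ⊤ (Metric.closedBall 0 ε),
      (fun z => ψ (z - x) - ψ (z - y)) ∈ divergences D := by
  refine hDc.induction₂ (fun x y => ∃ ε > 0, ∀ ψ ∈ Cc ⊤ (Metric.closedBall 0 ε),
    (fun z => ψ (z - x) - ψ (z - y)) ∈ divergences D) ?_ ?_ ?_ hx hy
  · intro x hx
    obtain ⟨r, hr, hrD⟩ := Metric.nhds_basis_closedBall.mem_iff.1 (hD.mem_nhds hx)
    filter_upwards [mem_nhdsWithin_of_mem_nhds (Metric.closedBall_mem_nhds x (half_pos hr))]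
      with y hy
    refine ⟨r / 2, half_pos hr, fun ψ hψ => ?_⟩
    have h := sub_convolution_mem_divergences (D := D) (ν := .dirac y) (k := 1) (c := x)
      (r := r / 2) hψ (integrable_const 1) (by simpa [ae_dirac_iff] using! hy) (by rwa [add_halves])
    simpa [convolution_mul] using h
  · rintro x y z - - - ⟨ε, hε, hxy⟩ ⟨δ, hδ, hyz⟩
    refine ⟨min ε δ, lt_min hε hδ, fun ψ hψ => ?_⟩
    convert add_mem
      (hxy ψ (Cc_mono le_rfl (Metric.closedBall_subset_closedBall (min_le_left ε δ)) hψ))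
      (hyz ψ (Cc_mono le_rfl (Metric.closedBall_subset_closedBall (min_le_right ε δ)) hψ)) using 1
    ext w
    simp
  · rintro x y - - ⟨ε, hε, h⟩
    refine ⟨ε, hε, fun ψ hψ => ?_⟩
    convert neg_mem (h ψ hψ) using 1
    ext w
    simp

/-- Mass distributed over `s` can be gathered at `c` by a flow in `D`: once smeared out by a smooth
function supported in the ball of radius `ε`, every mass density vanishing off `s` differs from the
point mass at `c` of the same total mass by a divergence. -/
def Gathers (D : Set (E n)) (c : E n) (ε : ℝ) (s : Set (E n)) : Prop :=
  ∀ ψ ∈ Cc ⊤ (Metric.closedBall 0 ε), ∀ k : E n → ℝ, Integrable k → (∀ y ∉ s, k y = 0) →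
    (fun x => (∫ y, k y) * ψ (x - c) - (k ⋆[ContinuousLinearMap.mul ℝ ℝ] ψ) x) ∈ divergences D

variable {c : E n} {ε δ : ℝ} {s t : Set (E n)}

theorem Gathers.mono (h : Gathers D c δ t) (hε : ε ≤ δ) (hst : s ⊆ t) : Gathers D c ε s :=
  fun ψ hψ k hk hks => h ψ (Cc_mono le_rfl (Metric.closedBall_subset_closedBall hε) hψ) k hk
    fun y hy => hks y fun hys => hy (hst hys)

theorem Gathers.union (hs : Gathers D c ε s) (hsm : MeasurableSet s) (ht : Gathers D c ε t) :
    Gathers D c ε (s ∪ t) := by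
  intro ψ hψ k hk hkst
  have hk₁ : Integrable (s.indicator k) := hk.indicator hsm
  have hk₂ : Integrable (sᶜ.indicator k) := hk.indicator hsm.compl
  have hkt : ∀ y ∉ t, sᶜ.indicator k y = 0 := fun y hy => by
    by_cases hys : y ∈ s <;> simp [hys, hy, hkst]
  have hexists {k : E n → ℝ} (hk : Integrable k) :
      ConvolutionExists k ψ (ContinuousLinearMap.mul ℝ ℝ) :=
    hψ.2.1.convolutionExists_right _ hk.locallyIntegrable hψ.1.continuous
  convert add_mem (hs ψ hψ _ hk₁ fun y hy => Set.indicator_of_notMem hy k)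
    (ht ψ hψ _ hk₂ hkt) using 1
  ext x
  conv_lhs => rw [← Set.indicator_self_add_compl s k]
  rw [(hexists hk₁).add_distrib (hexists hk₂)]
  simp only [Pi.add_apply, integral_add hk₁ hk₂]
  ring

theorem exists_gathers_closedBall (hD : IsOpen D) (hDc : IsPreconnected D) {x : E n}
    (hc : c ∈ D) (hx : x ∈ D) : ∃ r > 0, ∃ ε > 0, Gathers D c ε (Metric.closedBall x r) := by
  obtain ⟨r, hr, hrD⟩ := Metric.nhds_basis_closedBall.mem_iff.1 (hD.mem_nhds hx)
  obtain ⟨ε, hε, hcx⟩ := exists_translate_sub_translate_mem_divergences hD hDc hc hx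
  refine ⟨r / 2, half_pos hr, min ε (r / 2), lt_min hε (half_pos hr), fun ψ hψ k hk hkx => ?_⟩
  have hψε := Cc_mono le_rfl (Metric.closedBall_subset_closedBall (min_le_left ε (r / 2))) hψ
  have hψr := Cc_mono le_rfl (Metric.closedBall_subset_closedBall (min_le_right ε (r / 2))) hψ
  convert add_mem (Submodule.smul_mem _ (∫ y, k y) (hcx ψ hψε))
    (sub_convolution_mem_divergences hψr hk (c := x) (r := r / 2)
      (.of_forall fun y hy => by_contra fun hy' => hy (hkx y hy')) (by rwa [add_halves])) using 1
  ext z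
  simp only [Pi.add_apply, Pi.smul_apply, smul_eq_mul]
  ring

theorem exists_gathers_of_isCompact (hD : IsOpen D) (hDc : IsPreconnected D) (hc : c ∈ D)
    {K : Set (E n)} (hK : IsCompact K) (hKD : K ⊆ D) : ∃ ε > 0, Gathers D c ε K := by
  suffices ∃ s, K ⊆ s ∧ MeasurableSet s ∧ ∃ ε > 0, Gathers D c ε s by
    obtain ⟨s, hKs, -, ε, hε, h⟩ := this
    exact ⟨ε, hε, h.mono le_rfl hKs⟩
  refine hK.induction_on
    (p := fun K => ∃ s, K ⊆ s ∧ MeasurableSet s ∧ ∃ ε > 0, Gathers D c ε s) ?_ ?_ ?_ ?_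
  · refine ⟨∅, subset_rfl, MeasurableSet.empty, 1, one_pos, fun ψ _ k _ hk => ?_⟩
    obtain rfl : k = 0 := funext fun y => hk y (by simp)
    convert zero_mem (divergences D)
    simp
  · rintro K L hKL ⟨s, hLs, h⟩
    exact ⟨s, hKL.trans hLs, h⟩
  · rintro K L ⟨s, hKs, hsm, ε, hε, hs⟩ ⟨t, hLt, htm, δ, hδ, ht⟩
    exact ⟨s ∪ t, Set.union_subset_union hKs hLt, hsm.union htm, min ε δ, lt_min hε hδ,
      (hs.mono (min_le_left _ _) subset_rfl).union hsm (ht.mono (min_le_right _ _) subset_rfl)⟩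
  · intro x hx
    obtain ⟨r, hr, h⟩ := exists_gathers_closedBall hD hDc hc (hKD hx)
    exact ⟨Metric.closedBall x r, mem_nhdsWithin_of_mem_nhds (Metric.closedBall_mem_nhds x hr),
      _, subset_rfl, Metric.isClosed_closedBall.measurableSet, h⟩

end Gathering

theorem partialDeriv_coord_mul_radial {h : ℝ → ℝ} (hh : Differentiable ℝ h) (i j : Fin n)
    (z : E n) : partialDeriv j (fun z => z i * h (‖z‖ ^ 2)) z =
      (1 : Matrix (Fin n) (Fin n) ℝ) i j * h (‖z‖ ^ 2) +
        2 * deriv h (‖z‖ ^ 2) * (z i * z j) := by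
  have hcoord : HasFDerivAt (fun z : E n => z i) (EuclideanSpace.proj i : E n →L[ℝ] ℝ) z :=
    (EuclideanSpace.proj i : E n →L[ℝ] ℝ).hasFDerivAt
  have hradial : HasFDerivAt (fun z : E n => h (‖z‖ ^ 2))
      (deriv h (‖z‖ ^ 2) • 2 • innerSL ℝ z) z :=
    (hh _).hasDerivAt.comp_hasFDerivAt (h₂ := h) z (hasStrictFDerivAt_norm_sq z).hasFDerivAt
  have hprod : HasFDerivAt (fun z : E n => z i * h (‖z‖ ^ 2)) _ z := hcoord.mul hradial
  rw [partialDeriv, hprod.fderiv]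
  simp only [add_apply, smul_apply, coe_innerSL_apply, EuclideanSpace.inner_single_right,
    Real.ringHom_apply, one_mul, nsmul_eq_mul, Nat.cast_ofNat, smul_eq_mul, PiLp.proj_apply,
    PiLp.single_apply, mul_ite, mul_one, mul_zero, Matrix.one_apply, ite_mul, zero_mul]
  ring

theorem exists_mollifier_moment_curl_free (n : ℕ) {ε : ℝ} (hε : 0 < ε) :
    ∃ φ ∈ Cc ⊤ (Metric.closedBall (0 : E n) ε), ∫ z, φ z = 1 ∧ ∀ i j : Fin n,
      partialDeriv j (fun z => z i * φ z) = partialDeriv i fun z => z j * φ z := by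
  set h : ℝ → ℝ := fun s => Real.smoothTransition (1 - s / ε ^ 2)
  have hh : ContDiff ℝ ∞ h := Real.smoothTransition.contDiff.comp (by fun_prop)
  set η : E n → ℝ := fun z => h (‖z‖ ^ 2)
  have hηball : tsupport η ⊆ Metric.closedBall 0 ε := by
    refine closure_minimal (fun z hz => ?_) Metric.isClosed_closedBall
    by_contra hz'
    refine hz (Real.smoothTransition.zero_of_nonpos ?_)
    have : ε < ‖z‖ := by simpa using hz'
    rw [sub_nonpos, one_le_div (by positivity)]
    gcongr
  have hη : η ∈ Cc ⊤ (Metric.closedBall 0 ε) := ⟨hh.comp (contDiff_norm_sq ℝ),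
    (isCompact_closedBall _ _).of_isClosed_subset (isClosed_tsupport _) hηball, hηball⟩
  have hpos : 0 < ∫ z, η z :=
    hη.1.continuous.integral_pos_of_hasCompactSupport_nonneg_nonzero hη.2.1
      (fun z => Real.smoothTransition.nonneg _) (x := 0) (by simp [η, h])
  refine ⟨(∫ z, η z)⁻¹ • η, Submodule.smul_mem _ _ hη, ?_, fun i j => ?_⟩
  · simp only [Pi.smul_apply, smul_eq_mul, integral_const_mul, inv_mul_cancel₀ hpos.ne']
  · ext z
    have hd : Differentiable ℝ fun s => (∫ z, η z)⁻¹ * h s :=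
      (hh.differentiable (by simp)).const_mul _
    calc _ = _ := partialDeriv_coord_mul_radial hd i j z
      _ = _ := by rw [← Matrix.isSymm_one.apply, mul_comm (z i)]
      _ = _ := (partialDeriv_coord_mul_radial hd j i z).symm

/-- The components `∂ᵢYⱼ - ∂ⱼYᵢ` of the curl of `Y`. -/
def curl (Y : Fin n → E n → ℝ) (i j : Fin n) : E n → ℝ :=
  partialDeriv i (Y j) - partialDeriv j (Y i)

theorem exists_field_of_integral_eq_zero {P : E n → ℝ} (hD : IsOpen D) (hDc : IsConnected D)
    (hP : P ∈ Cc 1 D) (hP0 : ∫ x, P x = 0) :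
    ∃ Y : Fin n → E n → ℝ, (∀ i, Y i ∈ Cc 1 D) ∧ divergence Y = P ∧
      ∀ i j, curl Y i j ∈ Cc 1 D := by
  obtain ⟨c, hc⟩ := hDc.nonempty
  obtain ⟨ε, hε, hgather⟩ :=
    exists_gathers_of_isCompact hD hDc.isPreconnected hc hP.2.1.isCompact hP.2.2
  obtain ⟨δ, hδ, hδD⟩ := hP.2.1.isCompact.exists_cthickening_subset_open hD hP.2.2
  obtain ⟨φ, hφ, hφ1, hcurl⟩ := exists_mollifier_moment_curl_free n (lt_min hε hδ)
  have hPi : Integrable P := hP.1.continuous.integrable_of_hasCompactSupport hP.2.1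
  have hφi : Integrable φ := hφ.1.continuous.integrable_of_hasCompactSupport hφ.2.1
  have hφball : ∀ᵐ y, φ y ≠ 0 → y ∈ Metric.closedBall 0 (min ε δ) :=
    .of_forall fun y hy => hφ.2.2 (subset_tsupport _ hy)
  have hconv : (P ⋆[ContinuousLinearMap.mul ℝ ℝ] φ) ∈ divergences D := by
    have h := neg_mem (hgather.mono (min_le_left ε δ) subset_rfl φ hφ P hPi
      fun _ => image_eq_zero_of_notMem_tsupport)
    simpa [hP0, Pi.neg_def] using! h
  obtain ⟨W, hW, hdivW⟩ := hconv
  set T := segmentField volume φ 0 P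
  have hT : ∀ i, T i ∈ Cc 1 D := by
    refine segmentField_mem_Cc hφi hφball (S := tsupport P) ⟨hP.1, hP.2.1, subset_rfl⟩ ?_
    rw [IsCompact.add_closedBall_zero hP.2.1 (lt_min hε hδ).le]
    exact (Metric.cthickening_mono (min_le_right ε δ) _).trans hδD
  have hW1 : ∀ i, W i ∈ Cc 1 D := fun i => Cc_mono le_top subset_rfl (hW i)
  have hTd : ∀ i, Differentiable ℝ (T i) := fun i => (hT i).1.differentiable one_ne_zero
  have hWd : ∀ i, Differentiable ℝ (W i) := fun i => (hW1 i).1.differentiable one_ne_zero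
  have hdivT : divergence T = P - (P ⋆[ContinuousLinearMap.mul ℝ ℝ] φ) := by
    ext x
    rw [divergence_segmentField hφi hφball hP, hφ1, ← convolution_flip]
    simp
  refine ⟨T + W, fun i => add_mem (hT i) (hW1 i), ?_, fun i j => ?_⟩
  · rw [divergence_add hTd hWd, hdivT, hdivW, sub_add_cancel]
  · have hTcomm : partialDeriv i (T j) = partialDeriv j (T i) :=
      partialDeriv_segmentField_comm (Cc_mono le_top subset_rfl hφ) (hcurl j i) hP
    rw [curl, Pi.add_apply, Pi.add_apply, partialDeriv_add (hTd j) (hWd j),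
      partialDeriv_add (hTd i) (hWd i), hTcomm, add_sub_add_left_eq_sub]
    exact sub_mem (partialDeriv_mem_Cc (hW j) le_top i) (partialDeriv_mem_Cc (hW i) le_top j)

section WeakDivergence

theorem isTestFunction_iff_mem_Cc {χ : E n → ℝ} : IsTestFunction χ ↔ χ ∈ Cc ⊤ Set.univ := by
  simp [IsTestFunction, Cc]

/-- The equation `div V = g` in the sense of distributions, between a continuous vector field with
components `Vⱼ` and a continuous function. -/
structure HasWeakDiv (V : Fin n → E n → ℝ) (g : E n → ℝ) : Prop where
  continuous_field (j : Fin n) : Continuous (V j)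
  continuous_div : Continuous g
  integral_eq_zero (χ : E n → ℝ) (hχ : IsTestFunction χ) :
    ∫ x, ((∑ j, V j x * partialDeriv j χ x) + g x * χ x) = 0

variable {V W : Fin n → E n → ℝ} {g h χ : E n → ℝ}

theorem integrable_mul_of_mem_Cc {k : ℕ∞} (hg : Continuous g) (hh : h ∈ Cc k D) :
    Integrable fun x => g x * h x :=
  (hg.mul hh.1.continuous).integrable_of_hasCompactSupport hh.2.1.mul_left

theorem integrable_mul_partialDeriv (hV : ∀ j, Continuous (V j)) (hχ : χ ∈ Cc 1 D) :
    Integrable fun x => ∑ j, V j x * partialDeriv j χ x :=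
  integrable_finsetSum _ fun j _ =>
    integrable_mul_of_mem_Cc (hV j) (partialDeriv_mem_Cc hχ (zero_add 1).le j)

theorem HasWeakDiv.integrable (hV : HasWeakDiv V g) (hχ : IsTestFunction χ) :
    Integrable fun x => (∑ j, V j x * partialDeriv j χ x) + g x * χ x := by
  have hχ := Cc_mono (k := 1) le_top subset_rfl (isTestFunction_iff_mem_Cc.1 hχ)
  exact (integrable_mul_partialDeriv hV.continuous_field hχ).add
    (integrable_mul_of_mem_Cc hV.continuous_div hχ)

theorem HasWeakDiv.add (hV : HasWeakDiv V g) (hW : HasWeakDiv W h) :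
    HasWeakDiv (V + W) (g + h) where
  continuous_field j := (hV.continuous_field j).add (hW.continuous_field j)
  continuous_div := hV.continuous_div.add hW.continuous_div
  integral_eq_zero χ hχ := by
    have h := integral_add (hV.integrable hχ) (hW.integrable hχ)
    rw [hV.integral_eq_zero χ hχ, hW.integral_eq_zero χ hχ, add_zero] at h
    rw [← h]
    congr 1 with x
    simp only [Pi.add_apply, add_mul, Finset.sum_add_distrib]
    ring

theorem HasWeakDiv.const_smul (hV : HasWeakDiv V g) (a : ℝ) : HasWeakDiv (a • V) (a • g) where
  continuous_field j := (hV.continuous_field j).const_smul a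
  continuous_div := hV.continuous_div.const_smul a
  integral_eq_zero χ hχ := by
    have h := integral_const_mul (μ := volume) a fun x =>
      (∑ j, V j x * partialDeriv j χ x) + g x * χ x
    rw [hV.integral_eq_zero χ hχ, mul_zero] at h
    rw [← h]
    congr 1 with x
    simp only [Pi.smul_apply, smul_eq_mul, mul_assoc, ← Finset.mul_sum]
    ring

theorem hasWeakDiv_of_integral_eq_neg (hV : ∀ j, Continuous (V j)) (hg : Continuous g)
    (h : ∀ χ ∈ Cc ⊤ Set.univ, ∫ x, ∑ j, V j x * partialDeriv j χ x = -∫ x, g x * χ x) :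
    HasWeakDiv V g where
  continuous_field := hV
  continuous_div := hg
  integral_eq_zero χ hχ := by
    have hχ := isTestFunction_iff_mem_Cc.1 hχ
    rw [integral_add (integrable_mul_partialDeriv hV (Cc_mono le_top subset_rfl hχ))
      (integrable_mul_of_mem_Cc hg hχ), h χ hχ, neg_add_cancel]

theorem continuous_divergence (hV : ∀ j, ContDiff ℝ 1 (V j)) : Continuous (divergence V) := by
  simp only [divergence, Finset.sum_fn]
  exact continuous_finsetSum _ fun j _ => continuous_partialDeriv (hV j) j

theorem integral_sum_mul_partialDeriv (hV : ∀ j, ContDiff ℝ 1 (V j)) (hχ : χ ∈ Cc 1 D) :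
    ∫ x, ∑ j, V j x * partialDeriv j χ x = -∫ x, divergence V x * χ x := by
  simp only [divergence, Finset.sum_apply, Finset.sum_mul]
  rw [integral_finsetSum _ fun j _ => integrable_mul_of_mem_Cc (hV j).continuous
      (partialDeriv_mem_Cc hχ (zero_add 1).le j),
    integral_finsetSum _ fun j _ => integrable_mul_of_mem_Cc (continuous_partialDeriv (hV j) j) hχ,
    ← Finset.sum_neg_distrib]
  exact Finset.sum_congr rfl fun j _ => integral_mul_partialDeriv (hV j) hχ j

theorem hasWeakDiv_divergence (hV : ∀ j, ContDiff ℝ 1 (V j)) : HasWeakDiv V (divergence V) :=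
  hasWeakDiv_of_integral_eq_neg (fun j => (hV j).continuous) (continuous_divergence hV)
    fun _ hχ => integral_sum_mul_partialDeriv hV (Cc_mono le_top subset_rfl hχ)

theorem hasWeakDiv_single {f : E n → ℝ} (hf : ContDiff ℝ 1 f) (i : Fin n) :
    HasWeakDiv (Pi.single i f) (partialDeriv i f) := by
  have hsingle (j : Fin n) : ContDiff ℝ 1 ((Pi.single i f : Fin n → E n → ℝ) j) := by
    rcases eq_or_ne j i with rfl | hj
    · simpa using hf
    · simpa [hj] using! (contDiff_const : ContDiff ℝ 1 fun _ : E n => (0 : ℝ))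
  convert hasWeakDiv_divergence hsingle
  rw [divergence, Finset.sum_eq_single_of_mem i (Finset.mem_univ i) fun j _ hj => ?_]
  · simp
  · ext x
    simp [hj, partialDeriv]

theorem integral_partialDeriv_mul_partialDeriv_comm {f : E n → ℝ} (hf : ContDiff ℝ 1 f)
    (hχ : χ ∈ Cc 2 D) (i j : Fin n) :
    ∫ x, partialDeriv i f x * partialDeriv j χ x = ∫ x, partialDeriv j f x * partialDeriv i χ x :=
  integral_partialDeriv_mul_comm (v := fun i => partialDeriv i χ) hf
    (partialDeriv_mem_Cc hχ (by norm_num)) (partialDeriv_comm hχ.1 i j)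

theorem hasWeakDiv_partialDeriv (hV : ∀ j, ContDiff ℝ 1 (V j)) (hdiv : ContDiff ℝ 1 (divergence V))
    (i : Fin n) : HasWeakDiv (fun j => partialDeriv i (V j)) (partialDeriv i (divergence V)) := by
  refine hasWeakDiv_of_integral_eq_neg (fun j => continuous_partialDeriv (hV j) i)
    (continuous_partialDeriv hdiv i) fun χ hχ => ?_
  have hχ2 : χ ∈ Cc 2 Set.univ := Cc_mono le_top subset_rfl hχ
  have hint (i j k : Fin n) : Integrable fun x => partialDeriv i (V j) x * partialDeriv k χ x :=
    integrable_mul_of_mem_Cc (continuous_partialDeriv (hV j) i)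
      (partialDeriv_mem_Cc (k := 1) hχ2 (by norm_num) k)
  calc ∫ x, ∑ j, partialDeriv i (V j) x * partialDeriv j χ x
      = ∑ j, ∫ x, partialDeriv j (V j) x * partialDeriv i χ x := by
        rw [integral_finsetSum _ fun j _ => hint i j j]
        exact Finset.sum_congr rfl fun j _ =>
          integral_partialDeriv_mul_partialDeriv_comm (hV j) hχ2 i j
    _ = ∫ x, divergence V x * partialDeriv i χ x := by
        simp only [divergence, Finset.sum_apply, Finset.sum_mul]
        rw [integral_finsetSum _ fun j _ => hint j j i]
    _ = -∫ x, partialDeriv i (divergence V) x * χ x :=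
        integral_mul_partialDeriv hdiv (Cc_mono le_top subset_rfl hχ) i

theorem hasWeakDiv_divergence_of_antisymm {A : Fin n → Fin n → E n → ℝ}
    (hA : ∀ i j, ContDiff ℝ 1 (A i j)) (hanti : ∀ i j, A j i = -A i j) :
    HasWeakDiv (fun i => divergence (A i)) 0 := by
  refine hasWeakDiv_of_integral_eq_neg (fun i => continuous_divergence (hA i)) continuous_zero
    fun χ hχ => ?_
  have hχ2 : χ ∈ Cc 2 Set.univ := Cc_mono le_top subset_rfl hχ
  have hint (i j : Fin n) : Integrable fun x => partialDeriv j (A i j) x * partialDeriv i χ x :=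
    integrable_mul_of_mem_Cc (continuous_partialDeriv (hA i j) j)
      (partialDeriv_mem_Cc (k := 1) hχ2 (by norm_num) i)
  have hswap (i j : Fin n) : ∫ x, partialDeriv j (A i j) x * partialDeriv i χ x =
      -∫ x, partialDeriv i (A j i) x * partialDeriv j χ x := by
    rw [integral_partialDeriv_mul_partialDeriv_comm (hA i j) hχ2, ← integral_neg, hanti i j]
    congr 1 with x
    simp [partialDeriv, fderiv_neg]
  have hsum : ∫ x, ∑ i, divergence (A i) x * partialDeriv i χ x =
      ∑ i, ∑ j, ∫ x, partialDeriv j (A i j) x * partialDeriv i χ x := by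
    simp only [divergence, Finset.sum_apply, Finset.sum_mul]
    rw [integral_finsetSum _ fun i _ => integrable_finsetSum _ fun j _ => hint i j]
    exact Finset.sum_congr rfl fun i _ => integral_finsetSum _ fun j _ => hint i j
  have hneg : ∑ i, ∑ j, ∫ x, partialDeriv j (A i j) x * partialDeriv i χ x =
      -∑ i, ∑ j, ∫ x, partialDeriv j (A i j) x * partialDeriv i χ x := by
    conv_lhs => rw [Finset.sum_comm]
    simp only [← Finset.sum_neg_distrib, ← hswap]
  rw [hsum, self_eq_neg.1 hneg]
  simp

end WeakDivergence

section Flux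

theorem add_transpose_sub_trace_mem_symTraceless (A : Matrix (Fin n) (Fin n) ℝ) :
    A + A.transpose - (2 / n * A.trace) • 1 ∈ SymTraceless n := by
  refine ⟨by simp [add_comm], ?_⟩
  rcases eq_or_ne n 0 with rfl | hn
  · simp
  · simp only [Matrix.trace_sub, Matrix.trace_add, Matrix.trace_transpose, Matrix.trace_smul,
      Matrix.trace_one, Fintype.card_fin, smul_eq_mul]
    field_simp
    ring

/-- The deviatoric (trace-free symmetric) part `∇Y + ∇Yᵀ - (2/n) (div Y) I` of twice the
gradient of `Y`. -/
def deviatoricGrad (Y : Fin n → E n → ℝ) (x : E n) : SymTraceless n :=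
  ⟨_, add_transpose_sub_trace_mem_symTraceless (.of fun i j => partialDeriv i (Y j) x)⟩

theorem deviatoricGrad_apply (Y : Fin n → E n → ℝ) (x : E n) (i j : Fin n) :
    (deviatoricGrad Y x : Matrix (Fin n) (Fin n) ℝ) i j =
      partialDeriv i (Y j) x + partialDeriv j (Y i) x -
        2 / n * divergence Y x * (1 : Matrix (Fin n) (Fin n) ℝ) i j := by
  simp [deviatoricGrad, divergence, Matrix.trace]

variable {B : Matrix (Fin n) (Fin n) ℝ} {m : E n → E n} {U : E n → SymTraceless n} {P : E n → ℝ}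
  {Y : Fin n → E n → ℝ}

theorem continuous_stress_apply {X : Type*} [TopologicalSpace X] {U : X → SymTraceless n}
    (hU : Continuous U) (i j : Fin n) :
    Continuous fun x => (U x : Matrix (Fin n) (Fin n) ℝ) i j :=
  (continuous_apply_apply i j).comp hU.subtype_val

theorem weakMomentum_iff_hasWeakDiv (hm : Continuous m) (hU : Continuous U) (hP : Continuous P) :
    WeakMomentum B m U P ↔ ∀ i, HasWeakDiv
      ((fun j x => (U x : Matrix (Fin n) (Fin n) ℝ) i j) + Pi.single i P)
      (fun x => B.mulVec (m x).ofLp i) := by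
  have hrow (i : Fin n) (χ : E n → ℝ) (x : E n) :
      ∑ j, ((fun j x => (U x : Matrix (Fin n) (Fin n) ℝ) i j) + Pi.single i P :
          Fin n → E n → ℝ) j x * partialDeriv j χ x =
      (∑ j, (U x : Matrix (Fin n) (Fin n) ℝ) i j * partialDeriv j χ x) +
        P x * partialDeriv i χ x := by
    simp [add_mul, Finset.sum_add_distrib, Pi.single_apply, apply_ite (fun f : E n → ℝ => f x)]
  refine ⟨fun h i => ⟨fun j => ?_, ?_, fun χ hχ => ?_⟩, fun h i χ hχ => ?_⟩
  · refine (continuous_stress_apply hU i j).add ?_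
    rcases eq_or_ne j i with rfl | hj
    · simpa using hP
    · simpa [hj] using! (continuous_const : Continuous fun _ : E n => (0 : ℝ))
  · exact (continuous_apply i).comp
      (Continuous.matrix_mulVec continuous_const ((PiLp.continuous_ofLp 2 _).comp hm))
  · simpa only [hrow] using h i χ hχ
  · simpa only [hrow] using (h i).integral_eq_zero χ hχ

theorem WeakMomentum.add_const (h : WeakMomentum B m U P) (hm : Continuous m) (hU : Continuous U)
    (hP : Continuous P) (c : ℝ) : WeakMomentum B m U fun x => P x + c := by
  refine (weakMomentum_iff_hasWeakDiv hm hU (hP.add continuous_const)).2 fun i => ?_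
  have hrow := (weakMomentum_iff_hasWeakDiv hm hU hP).1 h i
  convert hrow.add (hasWeakDiv_single (f := fun _ => c) contDiff_const i) using 1
  · rw [add_assoc, ← Pi.single_add]
  · ext x
    simp [partialDeriv]

theorem continuous_deviatoricGrad (hY : ∀ i, ContDiff ℝ 1 (Y i)) :
    Continuous (deviatoricGrad Y) := by
  have hgrad (i j : Fin n) := continuous_partialDeriv (hY j) i
  have hdiv := continuous_divergence hY
  refine continuous_induced_rng.2 (continuous_pi fun i => continuous_pi fun j => ?_)
  simp only [Function.comp_apply, deviatoricGrad_apply]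
  fun_prop

/-- The factor `n / (2 (n - 1))`, for which the rows of `P I - c (∇Y + ∇Yᵀ - (2/n) P I)` with
`P = div Y` have divergence `c ∑ⱼ ∂ⱼ (∂ᵢYⱼ - ∂ⱼYᵢ)`. -/
def fluxConst (n : ℕ) : ℝ := n / (2 * (n - 1))

theorem fluxConst_mul_two_div_add_one (hn : 2 ≤ n) :
    fluxConst n * (2 / n) + 1 = 2 * fluxConst n := by
  have hn' : (2 : ℝ) ≤ n := by exact_mod_cast hn
  have h1 : (n : ℝ) - 1 ≠ 0 := by linarith
  unfold fluxConst
  field_simp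
  ring

theorem hasWeakDiv_stress_row (hn : 2 ≤ n) (hY : ∀ i, ContDiff ℝ 1 (Y i))
    (hdiv : ContDiff ℝ 1 (divergence Y)) (i : Fin n) (hcurl : ∀ j, ContDiff ℝ 1 (curl Y i j)) :
    HasWeakDiv ((fun j x =>
        ((-fluxConst n • deviatoricGrad Y x : SymTraceless n) : Matrix (Fin n) (Fin n) ℝ) i j) +
        Pi.single i (divergence Y))
      (fluxConst n • divergence (curl Y i)) := by
  set c := fluxConst n
  have hgrad := (hasWeakDiv_partialDeriv hY hdiv i).const_smul (-2 * c)
  have hrot := (hasWeakDiv_divergence hcurl).const_smul c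
  have hpressure := (hasWeakDiv_single hdiv i).const_smul (2 * c)
  convert (hgrad.add hrot).add hpressure using 1
  · ext j x
    have hcn := fluxConst_mul_two_div_add_one hn
    rcases eq_or_ne j i with rfl | hj
    · simp only [SetLike.val_smul, Matrix.smul_apply, deviatoricGrad_apply, smul_eq_mul,
        Pi.add_apply, Matrix.one_apply_eq, mul_one, Pi.single_eq_same, Pi.smul_apply, curl,
        sub_self, smul_zero, add_zero]
      linear_combination divergence Y x * hcn
    · simp only [SetLike.val_smul, Matrix.smul_apply, deviatoricGrad_apply, smul_eq_mul,
        Pi.add_apply, Matrix.one_apply_ne hj.symm, mul_zero, sub_zero, Pi.single_eq_of_ne hj,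
        Pi.zero_apply, add_zero, Pi.smul_apply, curl, smul_zero, Pi.sub_apply]
      ring
  · module

theorem partialDeriv_eq_zero_of_isOpen {f : E n → ℝ} {G : Set (E n)} (hG : IsOpen G)
    (hf : ∀ x ∈ G, f x = 0) (i : Fin n) : ∀ x ∈ G, partialDeriv i f x = 0 := fun x hx => by
  have hfx : f =ᶠ[nhds x] fun _ => 0 := Filter.eventually_of_mem (hG.mem_nhds hx) hf
  simp [partialDeriv, hfx.fderiv_eq]

theorem deviatoricGrad_eq_zero_of_isOpen {G : Set (E n)} (hG : IsOpen G)
    (hY : ∀ i, ∀ x ∈ G, Y i x = 0) : ∀ x ∈ G, deviatoricGrad Y x = 0 := fun x hx => by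
  have hgrad (i j : Fin n) := partialDeriv_eq_zero_of_isOpen hG (hY j) i x hx
  ext i j
  simp [deviatoricGrad_apply, divergence, hgrad]

theorem divergence_curl_eq_zero_of_isOpen {G : Set (E n)} (hG : IsOpen G)
    (hY : ∀ i, ∀ x ∈ G, Y i x = 0) (i : Fin n) : ∀ x ∈ G, divergence (curl Y i) x = 0 := by
  have hcurl (j : Fin n) : ∀ x ∈ G, curl Y i j x = 0 := fun x hx => by
    simp [curl, partialDeriv_eq_zero_of_isOpen hG (hY _) _ x hx]
  intro x hx
  simp [divergence, partialDeriv_eq_zero_of_isOpen hG (hcurl _) _ x hx]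

theorem exists_weak_solution {a : ℝ} (hn : 2 ≤ n) (ha : a ≠ 0) (hD : IsOpen D)
    (hDc : IsConnected D) (hP : P ∈ Cc 1 D) (hP0 : ∫ x, P x = 0) :
    ∃ (U : E n → SymTraceless n) (m : E n → E n), Continuous m ∧ Continuous U ∧
      HasCompactSupport (fun x => (m x, U x)) ∧ tsupport (fun x => (m x, U x)) ⊆ D ∧
      WeakDivFree m ∧ WeakMomentum (a • (1 : Matrix (Fin n) (Fin n) ℝ)) m U P := by
  obtain ⟨Y, hY, rfl, hcurl⟩ := exists_field_of_integral_eq_zero hD hDc hP hP0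
  set U : E n → SymTraceless n := fun x => -fluxConst n • deviatoricGrad Y x
  set m : E n → E n := fun x => WithLp.toLp 2 fun i => fluxConst n / a * divergence (curl Y i) x
  have hU : Continuous U :=
    (continuous_const_smul (-fluxConst n)).comp (continuous_deviatoricGrad fun i => (hY i).1)
  have hm : Continuous m := (PiLp.continuous_toLp 2 _).comp <| continuous_pi fun i =>
    continuous_const.mul (continuous_divergence fun j => (hcurl i j).1)
  obtain ⟨K, hK, hKD, hKY⟩ : ∃ K, IsCompact K ∧ K ⊆ D ∧ ∀ i, tsupport (Y i) ⊆ K :=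
    ⟨⋃ i, tsupport (Y i), isCompact_iUnion fun i => (hY i).2.1,
      Set.iUnion_subset fun i => (hY i).2.2, Set.subset_iUnion _⟩
  have hsupp : tsupport (fun x => (m x, U x)) ⊆ K := by
    refine closure_minimal (fun x hx => by_contra fun hxK => hx ?_) hK.isClosed
    have hYK : ∀ i, ∀ x ∈ Kᶜ, Y i x = 0 := fun i x hx =>
      image_eq_zero_of_notMem_tsupport fun hxY => hx (hKY i hxY)
    have hcurlK := divergence_curl_eq_zero_of_isOpen hK.isClosed.isOpen_compl hYK
    have hdevK := deviatoricGrad_eq_zero_of_isOpen hK.isClosed.isOpen_compl hYK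
    refine Prod.ext (PiLp.ext fun i => ?_) ?_
    · simp [m, hcurlK i x hxK]
    · simp [U, hdevK x hxK]
  refine ⟨U, m, hm, hU, hK.of_isClosed_subset (isClosed_tsupport _) hsupp, hsupp.trans hKD, ?_,
    (weakMomentum_iff_hasWeakDiv hm hU hP.1.continuous).2 fun i => ?_⟩
  · have hdivfree := (hasWeakDiv_divergence_of_antisymm (fun i j => (hcurl i j).1)
      fun i j => (neg_sub _ _).symm).const_smul (fluxConst n / a)
    exact fun χ hχ => by simpa [m] using! hdivfree.integral_eq_zero χ hχ
  · convert hasWeakDiv_stress_row hn (fun i => (hY i).1) hP.1 i fun j => (hcurl i j).1 using 1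
    ext x
    simp [m, Matrix.smul_mulVec, mul_div_cancel₀, ha, ← mul_assoc]

end Flux

section ConvexHull

variable {α β : ℝ}

/-- The defect `αβ I - (m ⊗ m - α U)` of a state `w = (m, U)`: it vanishes exactly on `K_{α, β}`
and, for `α > 0`, is positive semidefinite exactly on the convex hull of `K_{α, β}`. -/
def energyGap (α β : ℝ) (w : E n × SymTraceless n) : Matrix (Fin n) (Fin n) ℝ :=
  (α * β) • 1 - (tensorSq w.1 - α • (w.2 : Matrix (Fin n) (Fin n) ℝ))

theorem transpose_tensorSq (m : E n) : (tensorSq m).transpose = tensorSq m :=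
  Matrix.ext fun _ _ => mul_comm _ _

theorem trace_tensorSq (m : E n) : (tensorSq m).trace = ‖m‖ ^ 2 := by
  simp [EuclideanSpace.real_norm_sq_eq, Matrix.trace, tensorSq, ← sq]

theorem energyGap_apply (w : E n × SymTraceless n) (i j : Fin n) :
    energyGap α β w i j = α * β * (1 : Matrix (Fin n) (Fin n) ℝ) i j -
      (w.1 i * w.1 j - α * (w.2 : Matrix (Fin n) (Fin n) ℝ) i j) :=
  rfl

theorem isHermitian_energyGap (w : E n × SymTraceless n) : (energyGap α β w).IsHermitian := by
  simp [Matrix.IsHermitian, energyGap, transpose_tensorSq, w.2.2.1]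

theorem mem_constraintSet_iff_energyGap_eq_zero (hα : α ≠ 0) {w : E n × SymTraceless n} :
    w ∈ constraintSet n α β ↔ energyGap α β w = 0 := by
  have key : energyGap α β w = α •
      (β • 1 - (α⁻¹ • tensorSq w.1 - (w.2 : Matrix (Fin n) (Fin n) ℝ))) := by
    simp only [energyGap, smul_sub, smul_smul, mul_inv_cancel₀ hα, one_smul]
  rw [key, smul_eq_zero_iff_right hα, sub_eq_zero, eq_comm]
  rfl

theorem exists_energyGap_eq_sub_tensorSq (hα : α ≠ 0) (w : E n × SymTraceless n) {m e : E n}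
    (h : ‖m‖ ^ 2 = ‖w.1‖ ^ 2 + ‖e‖ ^ 2) :
    ∃ V, energyGap α β (m, V) = energyGap α β w - tensorSq e := by
  have hS : tensorSq m - tensorSq w.1 - tensorSq e ∈ SymTraceless n :=
    ⟨by simp only [Matrix.transpose_sub, transpose_tensorSq],
      by simp only [Matrix.trace_sub, trace_tensorSq, h]; ring⟩
  refine ⟨w.2 + α⁻¹ • ⟨_, hS⟩, Matrix.ext fun i j => ?_⟩
  simp only [energyGap_apply, Submodule.coe_add, Submodule.coe_smul, Matrix.add_apply,
    Matrix.smul_apply, Matrix.sub_apply, tensorSq, Matrix.of_apply, smul_eq_mul]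
  field_simp
  ring

theorem exists_pos_sq_add_mul_eq_one (b : ℝ) : ∃ s : ℝ, 0 < s ∧ s ^ 2 + 2 * b * s = 1 := by
  have hb : √(b ^ 2 + 1) ^ 2 = b ^ 2 + 1 := Real.sq_sqrt (by positivity)
  refine ⟨√(b ^ 2 + 1) - b, sub_pos.2 (Real.lt_sqrt_of_sq_lt (by linarith)), ?_⟩
  linear_combination hb

-- Moving `m` by `s e` or by `-s⁻¹ e` raises `|m|²` by the trace of `e ⊗ e`, so that a trace-free
-- change of `U` suffices to remove `e ⊗ e` from the gap.
theorem exists_pos_norm_sq_add_smul_eq (m e : E n) :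
    ∃ s : ℝ, 0 < s ∧ ‖m + s • e‖ ^ 2 = ‖m‖ ^ 2 + ‖e‖ ^ 2 ∧
      ‖m - s⁻¹ • e‖ ^ 2 = ‖m‖ ^ 2 + ‖e‖ ^ 2 := by
  rcases eq_or_ne e 0 with rfl | he
  · exact ⟨1, one_pos, by simp, by simp⟩
  obtain ⟨s, hs, hs1⟩ := exists_pos_sq_add_mul_eq_one (inner ℝ m e / ‖e‖ ^ 2)
  have he2 : ‖e‖ ≠ 0 := norm_ne_zero_iff.2 he
  have hs2 : s ^ 2 * ‖e‖ ^ 2 + 2 * inner ℝ m e * s = ‖e‖ ^ 2 := by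
    field_simp at hs1
    linear_combination hs1
  refine ⟨s, hs, ?_, ?_⟩
  · rw [norm_add_sq_real, inner_smul_right, norm_smul, mul_pow, Real.norm_eq_abs, sq_abs]
    linear_combination hs2
  · rw [norm_sub_sq_real, inner_smul_right, norm_smul, mul_pow, Real.norm_eq_abs, sq_abs]
    field_simp
    linear_combination -hs2

theorem exists_mem_segment_energyGap_eq_sub_tensorSq (hα : α ≠ 0) (w : E n × SymTraceless n)
    (e : E n) :
    ∃ w₁ w₂, energyGap α β w₁ = energyGap α β w - tensorSq e ∧
      energyGap α β w₂ = energyGap α β w - tensorSq e ∧ w ∈ segment ℝ w₁ w₂ := by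
  obtain ⟨s, hs, h₁, h₂⟩ := exists_pos_norm_sq_add_smul_eq w.1 e
  obtain ⟨V₁, hV₁⟩ := exists_energyGap_eq_sub_tensorSq (β := β) hα w h₁
  obtain ⟨V₂, hV₂⟩ := exists_energyGap_eq_sub_tensorSq (β := β) hα w h₂
  have hs2 : s ^ 2 + 1 ≠ 0 := by positivity
  refine ⟨_, _, hV₁, hV₂, 1 / (s ^ 2 + 1), s ^ 2 / (s ^ 2 + 1), by positivity, by positivity,
    by field_simp; ring, Prod.ext ?_ (Subtype.ext (Matrix.ext fun i j => ?_))⟩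
  · ext i
    simp only [Prod.fst_add, Prod.smul_fst, PiLp.add_apply, PiLp.sub_apply, PiLp.smul_apply,
      smul_eq_mul]
    field_simp
    ring
  · have e₁ := congrFun (congrFun hV₁ i) j
    have e₂ := congrFun (congrFun hV₂ i) j
    simp only [Matrix.sub_apply, energyGap_apply, tensorSq, Matrix.of_apply, PiLp.add_apply,
      PiLp.sub_apply, PiLp.smul_apply, smul_eq_mul] at e₁ e₂
    simp only [Prod.snd_add, Prod.smul_snd, Submodule.coe_add, Submodule.coe_smul,
      Matrix.add_apply, Matrix.smul_apply, smul_eq_mul]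
    field_simp at e₁ e₂ ⊢
    refine mul_left_cancel₀ hα ?_
    linear_combination e₁ + e₂

theorem mem_convexHull_of_energyGap_eq_sum (hα : α ≠ 0) {k : ℕ} (v : Fin k → E n)
    (w : E n × SymTraceless n) (hw : energyGap α β w = ∑ j, tensorSq (v j)) :
    w ∈ convexHull ℝ (constraintSet n α β) := by
  induction k generalizing w with
  | zero =>
    exact subset_convexHull ℝ _ ((mem_constraintSet_iff_energyGap_eq_zero hα).2 (by simpa using hw))
  | succ k ih =>
    obtain ⟨w₁, w₂, h₁, h₂, hseg⟩ :=
      exists_mem_segment_energyGap_eq_sub_tensorSq (β := β) hα w (v 0)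
    rw [hw, Fin.sum_univ_succ, add_sub_cancel_left] at h₁ h₂
    exact (convex_convexHull ℝ _).segment_subset (ih _ w₁ h₁) (ih _ w₂ h₂) hseg

theorem mem_convexHull_of_posSemidef_energyGap (hα : α ≠ 0) {w : E n × SymTraceless n}
    (hw : (energyGap α β w).PosSemidef) : w ∈ convexHull ℝ (constraintSet n α β) := by
  obtain ⟨k, v, hv⟩ := Matrix.posSemidef_iff_eq_sum_vecMulVec.1 hw
  exact mem_convexHull_of_energyGap_eq_sum hα (fun j => WithLp.toLp 2 (v j)) w hv

theorem abs_dotProduct_mulVec_le (A : Matrix (Fin n) (Fin n) ℝ) (v : E n) :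
    |v.ofLp ⬝ᵥ A.mulVec v.ofLp| ≤ (∑ i, ∑ j, |A i j|) * ‖v‖ ^ 2 := by
  simp only [dotProduct, Matrix.mulVec, Finset.mul_sum, Finset.sum_mul]
  refine (Finset.abs_sum_le_sum_abs _ _).trans (Finset.sum_le_sum fun i _ =>
    (Finset.abs_sum_le_sum_abs _ _).trans (Finset.sum_le_sum fun j _ => ?_))
  have hi : |v i| ≤ ‖v‖ := PiLp.norm_apply_le v i
  have hj : |v j| ≤ ‖v‖ := PiLp.norm_apply_le v j
  calc |v i * (A i j * v j)| = |A i j| * (|v i| * |v j|) := by simp only [abs_mul]; ring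
    _ ≤ |A i j| * (‖v‖ * ‖v‖) := by gcongr
    _ = |A i j| * ‖v‖ ^ 2 := by ring

theorem dotProduct_energyGap_mulVec (w : E n × SymTraceless n) (v : E n) :
    v.ofLp ⬝ᵥ (energyGap α β w).mulVec v.ofLp = α * β * ‖v‖ ^ 2 - inner ℝ w.1 v ^ 2 +
      α * (v.ofLp ⬝ᵥ (w.2 : Matrix (Fin n) (Fin n) ℝ).mulVec v.ofLp) := by
  have h₁ : v.ofLp ⬝ᵥ v.ofLp = ‖v‖ ^ 2 := by
    simp [EuclideanSpace.real_norm_sq_eq, dotProduct, ← sq]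
  have h₂ : v.ofLp ⬝ᵥ (tensorSq w.1).mulVec v.ofLp = inner ℝ w.1 v ^ 2 := by
    change v.ofLp ⬝ᵥ (Matrix.vecMulVec w.1.ofLp w.1.ofLp).mulVec v.ofLp = _
    simp [Matrix.vecMulVec_mulVec, EuclideanSpace.inner_eq_star_dotProduct, dotProduct_comm, sq]
  simp only [energyGap, Matrix.sub_mulVec, Matrix.smul_mulVec, Matrix.one_mulVec, dotProduct_sub,
    dotProduct_smul, h₁, h₂, smul_eq_mul]
  ring

/-- The explicit level `|m|² / α + ∑ |Uᵢⱼ|` of a state `w = (m, U)`, which dominates the largest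
eigenvalue of `(m ⊗ m) / α - U`. -/
def dominatingLevel (α : ℝ) (w : E n × SymTraceless n) : ℝ :=
  ‖w.1‖ ^ 2 / α + ∑ i, ∑ j, |(w.2 : Matrix (Fin n) (Fin n) ℝ) i j|

theorem posDef_energyGap_of_dominatingLevel_lt (hα : 0 < α) {w : E n × SymTraceless n}
    (h : dominatingLevel α w < β) : (energyGap α β w).PosDef := by
  replace h : ‖w.1‖ ^ 2 + α * ∑ i, ∑ j, |(w.2 : Matrix (Fin n) (Fin n) ℝ) i j| < α * β := by
    rwa [← mul_lt_mul_iff_right₀ hα, dominatingLevel, mul_add, mul_div_cancel₀ _ hα.ne'] at h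
  refine .of_dotProduct_mulVec_pos (isHermitian_energyGap w) fun x hx => ?_
  obtain ⟨v, rfl⟩ := (WithLp.ofLp_surjective 2) x
  have hv : 0 < ‖v‖ ^ 2 := by
    have : v ≠ 0 := fun h0 => hx (by simp [h0])
    positivity
  have h₁ : inner ℝ w.1 v ^ 2 ≤ ‖w.1‖ ^ 2 * ‖v‖ ^ 2 := by
    rw [← mul_pow]
    exact sq_le_sq' (neg_le_of_abs_le (abs_real_inner_le_norm _ _)) (real_inner_le_norm _ _)
  have h₂ := mul_le_mul_of_nonneg_left (neg_le_of_abs_le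
    (abs_dotProduct_mulVec_le (w.2 : Matrix (Fin n) (Fin n) ℝ) v)) hα.le
  have h₃ := mul_lt_mul_of_pos_right h hv
  rw [star_trivial, dotProduct_energyGap_mulVec]
  linarith

theorem continuous_dominatingLevel {X : Type*} [TopologicalSpace X] {ρ : X → ℝ} {m : X → E n}
    {U : X → SymTraceless n} (hρ : Continuous ρ) (hρ0 : ∀ x, ρ x ≠ 0) (hm : Continuous m)
    (hU : Continuous U) : Continuous fun x => dominatingLevel (ρ x) (m x, U x) :=
  ((hm.norm.pow 2).div₀ hρ hρ0).add (continuous_finsetSum _ fun i _ =>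
    continuous_finsetSum _ fun j _ => (continuous_stress_apply hU i j).abs)

theorem dominatingLevel_nonneg (hα : 0 ≤ α) (w : E n × SymTraceless n) :
    0 ≤ dominatingLevel α w := by
  unfold dominatingLevel
  positivity

theorem mem_interior_convexHull_of_dominatingLevel_lt (hα : 0 < α) {w : E n × SymTraceless n}
    (h : dominatingLevel α w < β) : w ∈ interior (convexHull ℝ (constraintSet n α β)) :=
  mem_interior.2 ⟨{w | dominatingLevel α w < β}, fun _ hw =>
      mem_convexHull_of_posSemidef_energyGap hα.ne'
        (posDef_energyGap_of_dominatingLevel_lt hα hw).posSemidef,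
    isOpen_lt (continuous_dominatingLevel continuous_const (fun _ => hα.ne') continuous_fst
      continuous_snd) continuous_const, h⟩

theorem bddAbove_dominatingLevel {ρ : E n → ℝ} {m : E n → E n} {U : E n → SymTraceless n}
    (hρ : Continuous ρ) (hρ0 : ∀ x, ρ x ≠ 0) (hm : Continuous m) (hU : Continuous U)
    (hs : HasCompactSupport fun x => (m x, U x)) :
    BddAbove (Set.range fun x => dominatingLevel (ρ x) (m x, U x)) := by
  refine (continuous_dominatingLevel hρ hρ0 hm hU).bddAbove_range_of_hasCompactSupport
    (hs.mono fun x hx h0 => hx ?_)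
  obtain ⟨hm0, hU0⟩ := Prod.mk_eq_zero.1 h0
  simp [dominatingLevel, hm0, hU0]

theorem IsStrictSubsolution.of_dominatingLevel_lt {p : ℝ → ℝ} {B : Matrix (Fin n) (Fin n) ℝ}
    {ρ : E n → ℝ} {m : E n → E n} {U : E n → SymTraceless n} {r R : ℝ}
    (hρ : Continuous ρ) (hρ_pos : ∀ x, 0 < ρ x) (hρR : ∀ x, |ρ x| ≤ R)
    (hm : Continuous m) (hU : Continuous U) (hs : HasCompactSupport fun x => (m x, U x))
    (hdiv : WeakDivFree m) (hmom : WeakMomentum B m U fun x => p (ρ x) + r)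
    (hr : ∀ x, dominatingLevel (ρ x) (m x, U x) < r) :
    IsStrictSubsolution p B ρ m U (fun _ => r) Set.univ where
  bdd_density := memLp_top_of_bound hρ.aestronglyMeasurable R (.of_forall hρR)
  bdd_momentum := hm.memLp_top_of_hasCompactSupport (hs.comp_left (g := Prod.fst) rfl) volume
  bdd_stress i j := (continuous_stress_apply hU i j).memLp_top_of_hasCompactSupport
    (hs.comp_left (g := fun w : E n × SymTraceless n => (w.2 : Matrix (Fin n) (Fin n) ℝ) i j)
      rfl) volume
  bdd_level := memLp_top_const r
  density_pos := .of_forall hρ_pos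
  div_free := hdiv
  momentum := hmom
  mem_hull := .of_forall fun x =>
    interior_subset (mem_interior_convexHull_of_dominatingLevel_lt (hρ_pos x) (hr x))
  isOpen_domain := isOpen_univ
  continuous_density := hρ
  continuous_momentum := hm
  continuous_stress := hU
  continuous_level := continuous_const
  density_pos_on x _ := hρ_pos x
  level_pos_on x _ := (dominatingLevel_nonneg (hρ_pos x).le _).trans_lt (hr x)
  mem_interior_hull x _ := mem_interior_convexHull_of_dominatingLevel_lt (hρ_pos x) (hr x)

theorem exists_abs_le_of_eq_const_off {f : E n → ℝ} {Ω : Set (E n)} {c : ℝ} (hf : Continuous f)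
    (hΩ : Bornology.IsBounded Ω) (hfΩ : ∀ x ∉ Ω, f x = c) : ∃ C, ∀ x, |f x| ≤ C := by
  obtain ⟨C, hC⟩ := hΩ.isCompact_closure.exists_bound_of_continuousOn hf.continuousOn
  refine ⟨max C |c|, fun x => ?_⟩
  by_cases hx : x ∈ Ω
  · exact (hC x (subset_closure hx)).trans (le_max_left _ _)
  · exact (congrArg abs (hfΩ x hx)).le.trans (le_max_right _ _)

theorem sub_const_mem_Cc {k : ℕ∞} {f : E n → ℝ} {Ω : Set (E n)} {c : ℝ}
    (hf : ContDiff ℝ k f) (hΩ : Bornology.IsBounded Ω) (hΩD : closure Ω ⊆ D)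
    (hfΩ : ∀ x ∉ Ω, f x = c) : (fun x => f x - c) ∈ Cc k D := by
  have hsupp : tsupport (fun x => f x - c) ⊆ closure Ω :=
    closure_mono (Function.support_subset_iff'.2 fun x hx => sub_eq_zero.2 (hfΩ x hx))
  exact ⟨hf.sub contDiff_const, hΩ.isCompact_closure.of_isClosed_subset (isClosed_tsupport _) hsupp,
    hsupp.trans hΩD⟩

theorem integral_sub_const_eq_zero {f : E n → ℝ} {Ω : Set (E n)} {c : ℝ} (hf : Continuous f)
    (hΩ : Bornology.IsBounded Ω) (hfΩ : ∀ x ∉ Ω, f x = c)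
    (hint : ∫ x in Ω, f x = c * (volume Ω).toReal) : ∫ x, (f x - c) = 0 := by
  have hfi : IntegrableOn f Ω :=
    (hf.continuousOn.integrableOn_compact hΩ.isCompact_closure).mono_set subset_closure
  rw [← setIntegral_eq_integral_of_forall_compl_eq_zero fun x hx => sub_eq_zero.2 (hfΩ x hx),
    integral_sub hfi (integrableOn_const hΩ.measure_lt_top.ne), hint, setIntegral_const,
    smul_eq_mul, mul_comm, sub_eq_zero]
  rfl

end ConvexHull

end SteadyEuler

end

theorem proposition4p5_general (n : ℕ) (hn : 2 ≤ n) (a : ℝ) (ha : a ≠ 0)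
    (Ω Ω' : Set (EuclideanSpace ℝ (Fin n))) (hΩ_bdd : Bornology.IsBounded Ω)
    (hΩ'_open : IsOpen Ω') (hΩ'_conn : IsConnected Ω') (hΩΩ' : closure Ω ⊆ Ω')
    (ρ : EuclideanSpace ℝ (Fin n) → ℝ) (hρ : Continuous ρ) (hρ_pos : ∀ x, 0 < ρ x)
    (ρbar : ℝ) (hρbar : ∀ x, x ∉ Ω → ρ x = ρbar)
    (p : ℝ → ℝ) (hpρ : ContDiff ℝ 1 fun x => p (ρ x))
    (hint : ∫ x in Ω, p (ρ x) = p ρbar * (MeasureTheory.volume Ω).toReal) :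
    ∃ (U : EuclideanSpace ℝ (Fin n) → SteadyEuler.SymTraceless n)
      (m : EuclideanSpace ℝ (Fin n) → EuclideanSpace ℝ (Fin n))
      (χ : ℝ) (q : EuclideanSpace ℝ (Fin n) → ℝ),
      (∀ x, q x = p (ρ x) + χ / n) ∧
      Continuous m ∧ Continuous U ∧
      HasCompactSupport (fun x => (m x, U x)) ∧
      tsupport (fun x => (m x, U x)) ⊆ Ω' ∧
      SteadyEuler.WeakDivFree m ∧
      SteadyEuler.WeakMomentum (a • 1) m U q ∧
      (∀ x, ((ρ x * q x) • (1 : Matrix (Fin n) (Fin n) ℝ)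
        - (SteadyEuler.tensorSq (m x) - ρ x • (U x : Matrix (Fin n) (Fin n) ℝ))).PosDef) ∧
      (∀ x, 0 < q x ∧
        (m x, U x) ∈ interior (convexHull ℝ (SteadyEuler.constraintSet n (ρ x) (q x)))) ∧
      SteadyEuler.IsStrictSubsolution p (a • 1) ρ m U (fun _ => χ / n) Set.univ := by
  have hpρbar : ∀ x ∉ Ω, p (ρ x) = p ρbar := fun x hx => congrArg p (hρbar x hx)
  obtain ⟨U, m, hm, hU, hsupp, hsuppΩ', hdiv, hmom⟩ := SteadyEuler.exists_weak_solution hn ha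
    hΩ'_open hΩ'_conn (SteadyEuler.sub_const_mem_Cc hpρ hΩ_bdd hΩΩ' hpρbar)
    (SteadyEuler.integral_sub_const_eq_zero hpρ.continuous hΩ_bdd hpρbar hint)
  obtain ⟨b, hb⟩ := SteadyEuler.bddAbove_dominatingLevel hρ (fun x => (hρ_pos x).ne') hm hU hsupp
  obtain ⟨R, hR⟩ := SteadyEuler.exists_abs_le_of_eq_const_off hρ hΩ_bdd hρbar
  obtain ⟨Q, hQ⟩ := SteadyEuler.exists_abs_le_of_eq_const_off hpρ.continuous hΩ_bdd hpρbar
  set r : ℝ := b + Q + 1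
  have hlevel (x) : SteadyEuler.dominatingLevel (ρ x) (m x, U x) < r ∧
      SteadyEuler.dominatingLevel (ρ x) (m x, U x) < p (ρ x) + r := by
    have h₁ := hb (Set.mem_range_self x)
    have h₂ := abs_le.1 (hQ x)
    constructor <;> linarith
  have hχ : n * r / n = r := mul_div_cancel_left₀ r (by positivity)
  have hmom_r : SteadyEuler.WeakMomentum (a • 1) m U fun x => p (ρ x) + r := by
    simpa only [← add_assoc, sub_add_cancel] using
      hmom.add_const hm hU (hpρ.continuous.sub continuous_const) (p ρbar + r)
  refine ⟨U, m, n * r, fun x => p (ρ x) + r, fun x => by rw [hχ], hm, hU, hsupp, hsuppΩ', hdiv,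
    hmom_r, fun x => SteadyEuler.posDef_energyGap_of_dominatingLevel_lt (hρ_pos x) (hlevel x).2,
    fun x => ⟨(SteadyEuler.dominatingLevel_nonneg (hρ_pos x).le _).trans_lt (hlevel x).2,
      SteadyEuler.mem_interior_convexHull_of_dominatingLevel_lt (hρ_pos x) (hlevel x).2⟩, ?_⟩
  rw [hχ]
  exact .of_dominatingLevel_lt hρ hρ_pos hR hm hU hsupp hdiv hmom_r fun x => (hlevel x).1

theorem proposition4p5 (n : ℕ) (hn : 3 ≤ n) (a : ℝ) (ha : a ≠ 0)
    (B : Matrix (Fin n) (Fin n) ℝ) (hB : B = a • (1 : Matrix (Fin n) (Fin n) ℝ))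
    (Ω Ω' : Set (EuclideanSpace ℝ (Fin n)))
    (hΩ_open : IsOpen Ω)
    (hΩ'_open : IsOpen Ω') (hΩ'_conn : IsConnected Ω') (hΩ'_bdd : Bornology.IsBounded Ω')
    (hΩΩ' : closure Ω ⊆ Ω')
    (ρ : EuclideanSpace ℝ (Fin n) → ℝ) (hρ : ContDiff ℝ 1 ρ) (hρ_pos : ∀ x, 0 < ρ x)
    (ρbar : ℝ) (hρbar : ∀ x, x ∉ Ω → ρ x = ρbar)
    (p : ℝ → ℝ) (hp : ContDiffOn ℝ 1 p (Set.Ioi 0))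
    (hint : ∫ x in Ω, p (ρ x) = p ρbar * (MeasureTheory.volume Ω).toReal) :
    ∃ (U : EuclideanSpace ℝ (Fin n) → SteadyEuler.SymTraceless n)
      (m : EuclideanSpace ℝ (Fin n) → EuclideanSpace ℝ (Fin n))
      (χ : ℝ) (q : EuclideanSpace ℝ (Fin n) → ℝ),
      (∀ x, q x = p (ρ x) + χ / n) ∧
      Continuous m ∧ Continuous U ∧
      HasCompactSupport (fun x => (m x, U x)) ∧
      tsupport (fun x => (m x, U x)) ⊆ Ω' ∧
      SteadyEuler.WeakDivFree m ∧
      SteadyEuler.WeakMomentum B m U q ∧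
      (∀ x, ((ρ x * q x) • (1 : Matrix (Fin n) (Fin n) ℝ)
        - (SteadyEuler.tensorSq (m x) - ρ x • (U x : Matrix (Fin n) (Fin n) ℝ))).PosDef) ∧
      (∀ x, 0 < q x ∧
        (m x, U x) ∈ interior (convexHull ℝ (SteadyEuler.constraintSet n (ρ x) (q x)))) ∧
      SteadyEuler.IsStrictSubsolution p B ρ m U (fun _ => χ / n) Set.univ := by
  subst hB
  exact proposition4p5_general n (by omega) a ha Ω Ω'
    (hΩ'_bdd.subset (subset_closure.trans hΩΩ')) hΩ'_open hΩ'_conn hΩΩ' ρ hρ.continuous hρ_pos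
    ρbar hρbar p (contDiffOn_univ.1 (hp.comp hρ.contDiffOn fun x _ => hρ_pos x)) hint
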